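/- A Lie--Jordan algebra is a real vector space $\mathcal L$ with a symmetric bilinear product $\circ$ and a Lie bracket $[\cdot,\cdot]$ (bilinear, antisymmetric, satisfying the Jacobi identity) such that for all $a,b,c\in\mathcal L$ $$[a,b\circ c]=[a,b]\circ c+b\circ[a,c],\qquad (a\circ b)\circ c-a\circ(b\circ c)=[b,[c,a]].$$ An identity is an element $1$ with $1\circ x=x$ for all $x$; there is at most one, and it is central for the bracket. Let $\mathbb R1$ be the line spanned by the identity if there is one, and $0$ otherwise. Call $\mathcal L$ semisimple if the Lie algebra $\mathcal L/\mathbb R1$ is semisimple (so, if there is no identity, if the Lie algebra $\mathcal L$ is semisimple). Theorem. Let $\mathcal L$ be a finite-dimensional semisimple Lie--Jordan algebra. Then the Jordan algebra $(\mathcal L,\circ)$ is generated by three elements together with the identity (if there is one); that is, there are three elements such that every element of $\mathcal L$ is a linear combination of iterated Jordan products of these three elements and the identity. More precisely, there exist $a,b\in\mathcal L$ that, together with the identity (if there is one), generate the Lie algebra $(\mathcal L,[\cdot,\cdot])$; and for all such $a,b$ the three elements $a$, $b$ and $c=[a,b]$, together with the identity (if there is one), generate the Jordan algebra $(\mathcal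 L,\circ)$. -/

import Mathlib

/-- A Lie–Jordan algebra: a real vector space with a Lie bracket and a symmetric bilinear
product `jmul` (the Jordan product) satisfying the Leibniz identity and the associator identity.
Antisymmetry, bilinearity and the Jacobi identity of the bracket are in `LieRing` and
`LieAlgebra ℝ`. No identity element is assumed. -/
class LieJordanAlgebra (L : Type*) [LieRing L] [LieAlgebra ℝ L] where
  /-- the Jordan product -/
  jmul : L →ₗ[ℝ] L →ₗ[ℝ] L
  jmul_comm : ∀ a b : L, jmul a b = jmul b a
  leibniz : ∀ a b c : L, ⁅a, jmul b c⁆ = jmul ⁅a, b⁆ c + jmul b ⁅a, c⁆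
  associator : ∀ a b c : L, jmul (jmul a b) c - jmul a (jmul b c) = ⁅b, ⁅c, a⁆⁆

namespace LieJordanAlgebra

variable (L : Type*) [LieRing L] [LieAlgebra ℝ L] [LieJordanAlgebra L]

/-- The set of identity elements for the Jordan product: `{1}` if `L` is unital, and empty
otherwise. -/
def identities : Set L := {e | ∀ x : L, jmul e x = x}

theorem lie_identity {e : L} (he : e ∈ identities L) (x : L) : ⁅x, e⁆ = 0 := by
  have h := leibniz x e e
  rw [he e, jmul_comm ⁅x, e⁆ e, he ⁅x, e⁆] at h
  simpa using h

/-- The Lie ideal `ℝ1` spanned by the identity (the zero ideal if there is no identity). -/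
def identityIdeal : LieIdeal ℝ L where
  toSubmodule := Submodule.span ℝ (identities L)
  lie_mem := by
    intro x m hm
    have h : ⁅x, m⁆ = 0 := by
      change m ∈ Submodule.span ℝ (identities L) at hm
      induction hm using Submodule.span_induction with
      | mem e he => exact lie_identity L he x
      | zero => simp
      | add u v _ _ hu hv => simp [hu, hv]
      | smul r u _ hu => simp [hu]
    rw [h]
    exact (Submodule.span ℝ (identities L)).zero_mem

/-- A Lie–Jordan algebra is semisimple if its Lie algebra, considered modulo the multiples of the
identity, is semisimple. If there is no identity, the ideal divided out is zero, and the condition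
says that the Lie algebra `L` itself is semisimple. (An identity is central for the bracket, so it
always has to be set aside.) -/
def IsSemisimple : Prop := LieAlgebra.IsSemisimple ℝ (L ⧸ identityIdeal L)

variable {L}

/-- `IsJordanProduct s x`: the element `x` is an iterated Jordan product, bracketed in any way, of
(one or more) elements of `s`. -/
inductive IsJordanProduct (s : Set L) : L → Prop
  | of (x : L) (hx : x ∈ s) : IsJordanProduct s x
  | mul (x y : L) (hx : IsJordanProduct s x) (hy : IsJordanProduct s y) :
      IsJordanProduct s (jmul x y)

/-- The set `s`, together with the identity (if there is one), generates the Jordan algebra `L`: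
every element is a linear combination of Jordan products of these elements. -/
def JordanGenerates (s : Set L) : Prop :=
  Submodule.span ℝ {x | IsJordanProduct (identities L ∪ s) x} = ⊤

/-- The set `s`, together with the identity (if there is one), generates the Lie algebra `L`. -/
def LieGenerates (s : Set L) : Prop :=
  LieSubalgebra.lieSpan ℝ L (identities L ∪ s) = ⊤

end LieJordanAlgebra

/-!
The three assertions reduce to two facts.

The first is that Lie generators `a`, `b` give Jordan generators `a`, `b`, `⁅a, b⁆`
(`LieJordanAlgebra.LieGenerates.jordanGenerates`). By the associator identity a Jordan subalgebra
`S` is closed under the double bracket `⁅x, ⁅y, z⁆⁆`. If `S` contains `a`, `b` and `⁅a, b⁆`, then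
the subspace `T` of those `z ∈ S` with `⁅a, z⁆ ∈ S` and `⁅b, z⁆ ∈ S` contains `a` and `b` and is
stable under `ad a` and `ad b`. The identity is central, so if `a`, `b` and the identity generate
the Lie algebra, then `T` is a Lie ideal containing a generating set, and `S` is everything.

The second is that a semisimple Lie algebra in characteristic zero is generated by two elements
(`LieAlgebra.IsKilling.exists_lieSpan_pair_eq_top`), here applied to `L ⧸ ℝ1`, whose Killing form is
nondegenerate by Cartan's criterion. Over an algebraically closed field, let `h` be an element of a
Cartan subalgebra at which distinct weights take distinct values, and let `b` be a sum of nonzero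
weight vectors, one for each weight. The components of `b` are polynomials in `ad h` applied to `b`,
so `h` and `b` generate the root spaces, which are one-dimensional, hence the coroots, hence the
Cartan subalgebra. The passage to a general field is by genericity: for a pair to generate it
suffices that some polynomial in the coordinates, with coefficients in the ground field, does not
vanish; if it does not vanish at a pair over an extension, it is a nonzero polynomial,
and so it is nonzero at some pair over the (infinite) ground field.
-/

/-! ### Jordan subalgebras as Lie triple systems -/

namespace LieJordanAlgebra

variable {L : Type*} [LieRing L] [LieAlgebra ℝ L] [LieJordanAlgebra L]

/-- The span of the Jordan products of elements of `s` is closed under the Jordan product. -/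
theorem jmul_mem_span_isJordanProduct {s : Set L} {x y : L}
    (hx : x ∈ Submodule.span ℝ {x | IsJordanProduct s x})
    (hy : y ∈ Submodule.span ℝ {x | IsJordanProduct s x}) :
    jmul x y ∈ Submodule.span ℝ {x | IsJordanProduct s x} := by
  induction hx, hy using Submodule.span_induction₂ with
  | mem_mem x y hx hy => exact Submodule.subset_span (.mul x y hx hy)
  | zero_left => simp
  | zero_right => simp
  | add_left x y z _ _ _ hx hy => simpa using add_mem hx hy
  | add_right x y z _ _ _ hx hy => simpa using add_mem hx hy
  | smul_left r x y _ _ h => simpa using Submodule.smul_mem _ r h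
  | smul_right r x y _ _ h => simpa using Submodule.smul_mem _ r h

/-- By the associator identity, a Jordan subalgebra is a Lie triple system: it is closed under
double brackets, although not, in general, under brackets. -/
theorem lie_lie_mem_span_isJordanProduct {s : Set L} {x y z : L}
    (hx : x ∈ Submodule.span ℝ {x | IsJordanProduct s x})
    (hy : y ∈ Submodule.span ℝ {x | IsJordanProduct s x})
    (hz : z ∈ Submodule.span ℝ {x | IsJordanProduct s x}) :
    ⁅x, ⁅y, z⁆⁆ ∈ Submodule.span ℝ {x | IsJordanProduct s x} := by
  rw [← associator]
  exact sub_mem (jmul_mem_span_isJordanProduct (jmul_mem_span_isJordanProduct hz hx) hy)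
    (jmul_mem_span_isJordanProduct hz (jmul_mem_span_isJordanProduct hx hy))

/-- If `a` and `b` generate the Lie algebra, then `a`, `b` and `⁅a, b⁆` generate the Jordan algebra
(in both cases together with the identity, if there is one). -/
theorem LieGenerates.jordanGenerates {a b : L} (h : LieGenerates ({a, b} : Set L)) :
    JordanGenerates ({a, b, ⁅a, b⁆} : Set L) := by
  set S := Submodule.span ℝ {x | IsJordanProduct (identities L ∪ {a, b, ⁅a, b⁆}) x}
  have mem_S {x : L} (hx : x ∈ identities L ∪ {a, b, ⁅a, b⁆}) : x ∈ S :=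
    Submodule.subset_span (.of x hx)
  have ha : a ∈ S := mem_S (by simp)
  have hb : b ∈ S := mem_S (by simp)
  have hab : ⁅a, b⁆ ∈ S := mem_S (by simp)
  -- `T` is stable under `ad a` and `ad b`, because `S` is closed under double brackets.
  let T : Submodule ℝ L := S ⊓ S.comap (LieAlgebra.ad ℝ L a) ⊓
    S.comap (LieAlgebra.ad ℝ L b)
  have mem_T {x : L} : x ∈ T ↔ (x ∈ S ∧ ⁅a, x⁆ ∈ S) ∧ ⁅b, x⁆ ∈ S := Iff.rfl
  have generator_mem {x : L} (hx : x ∈ identities L ∪ {a, b}) : x ∈ T := by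
    rw [mem_T]
    rcases hx with hx | rfl | rfl
    · simp [lie_identity L hx, mem_S (Or.inl hx)]
    · exact ⟨⟨ha, by simp⟩, by rw [← lie_skew]; exact neg_mem hab⟩
    · exact ⟨⟨hb, hab⟩, by simp⟩
  -- Hence `T` is a Lie ideal: the elements whose adjoint action preserves `T` form a subalgebra.
  have lie_mem (x : L) : ∀ z ∈ T, ⁅x, z⁆ ∈ T := by
    have hx : x ∈ LieSubalgebra.lieSpan ℝ L (identities L ∪ {a, b}) := by rw [h]; trivial
    induction hx using LieSubalgebra.lieSpan_induction with
    | mem x hx =>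
      intro z hz
      rw [mem_T] at hz ⊢
      rcases hx with hx | rfl | rfl
      · rw [← lie_skew, lie_identity L hx]
        simp
      · exact ⟨⟨hz.1.2, lie_lie_mem_span_isJordanProduct ha ha hz.1.1⟩,
          lie_lie_mem_span_isJordanProduct hb ha hz.1.1⟩
      · exact ⟨⟨hz.2, lie_lie_mem_span_isJordanProduct ha hb hz.1.1⟩,
          lie_lie_mem_span_isJordanProduct hb hb hz.1.1⟩
    | zero => simp
    | add x y _ _ hx hy => intro z hz; rw [add_lie]; exact add_mem (hx z hz) (hy z hz)
    | smul r x _ hx => intro z hz; rw [smul_lie]; exact T.smul_mem r (hx z hz)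
    | lie x y _ _ hx hy =>
      intro z hz
      rw [lie_lie]
      exact sub_mem (hx _ (hy z hz)) (hy _ (hx z hz))
  refine eq_top_iff.mpr fun x _ ↦ ?_
  have hx : x ∈ LieSubalgebra.lieSpan ℝ L (identities L ∪ {a, b}) := by rw [h]; trivial
  suffices x ∈ T from this.1.1
  induction hx using LieSubalgebra.lieSpan_induction with
  | mem x hx => exact generator_mem hx
  | zero => exact zero_mem _
  | add x y _ _ hx hy => exact add_mem (hx trivial) (hy trivial)
  | smul r x _ hx => exact T.smul_mem r (hx trivial)
  | lie x y _ _ _ hy => exact lie_mem x y (hy trivial)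

end LieJordanAlgebra

/-! ### Two generators over an algebraically closed field -/

section

open LieAlgebra LieAlgebra.IsKilling LieModule Module

/-- Over an algebraically closed field the generators are an element of a Cartan subalgebra at which
all weights take distinct values, and a sum of nonzero weight vectors, one for each weight. -/
theorem LieAlgebra.IsKilling.exists_lieSpan_pair_eq_top_of_isAlgClosed (K g : Type*) [Field K]
    [CharZero K] [IsAlgClosed K] [LieRing g] [LieAlgebra K g] [FiniteDimensional K g]
    [IsKilling K g] : ∃ a b : g, LieSubalgebra.lieSpan K g {a, b} = ⊤ := by
  classical
  obtain ⟨u, hu⟩ := LieAlgebra.exists_isCartanSubalgebra_engel K g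
  set H := LieSubalgebra.engel K u
  -- Finitely many hyperplanes do not cover `H`, so some `h` separates the weights.
  obtain ⟨h, hh⟩ : ∃ h : H, ∀ p : {p : Weight K H g × Weight K H g // p.1 ≠ p.2},
      (p.1.1.toLinear - p.1.2.toLinear) h ≠ 0 := by
    refine Module.Dual.exists_forall_ne_zero_of_forall_exists _ fun p ↦ ?_
    by_contra! hp
    exact p.2 (Weight.ext fun x ↦ by simpa [sub_eq_zero] using hp x)
  have h_inj : Function.Injective fun α : Weight K H g ↦ α h := by
    intro α β hαβ
    by_contra hne
    exact hh ⟨(α, β), hne⟩ (by simpa [sub_eq_zero] using hαβ)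
  -- The zero weight contributes a harmless element of `H` to the sum below.
  choose e he he0 using fun α : Weight K H g ↦ α.exists_ne_zero
  refine ⟨h, ∑ α, e α, ?_⟩
  set N := LieSubalgebra.lieSpan K g {(h : g), ∑ α, e α}
  have h_mem : (h : g) ∈ N := LieSubalgebra.subset_lieSpan (by simp)
  have sum_mem : ∑ α, e α ∈ N := LieSubalgebra.subset_lieSpan (by simp)
  have lie_e (α : Weight K H g) : ad K g h (e α) = α h • e α :=
    lie_eq_smul_of_mem_rootSpace (he α) h
  have e_mem (α : Weight K H g) : e α ∈ N := by
    -- A Lagrange polynomial in `ad h` projects the sum to its component of weight `α`.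
    have : Polynomial.aeval (ad K g h) (Lagrange.basis Finset.univ (fun β : Weight K H g ↦ β h) α)
        (∑ β, e β) = e α := by
      rw [map_sum, Finset.sum_eq_single α]
      · rw [Module.End.aeval_apply_of_mem_apply_eq_smul (lie_e α),
          Lagrange.eval_basis_self h_inj.injOn (Finset.mem_univ α), one_smul]
      · intro β _ hβ
        rw [Module.End.aeval_apply_of_mem_apply_eq_smul (lie_e β),
          Lagrange.eval_basis_of_ne (v := fun β : Weight K H g ↦ β h) hβ.symm (Finset.mem_univ β),
          zero_smul]
      · simp
    rw [← this]
    exact Polynomial.aeval_apply_smul_mem_of_le_comap (q := N.toSubmodule) sum_mem _ _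
      fun x hx ↦ N.lie_mem h_mem hx
  have rootSpace_le (α : Weight K H g) (hα : α.IsNonZero) {x : g} (hx : x ∈ rootSpace H α) :
      x ∈ N := by
    obtain ⟨c, hc⟩ := (finrank_eq_one_iff_of_nonzero' (⟨e α, he α⟩ : rootSpace H α)
      (by simpa [Subtype.ext_iff] using he0 α)).mp (finrank_rootSpace_eq_one α hα) ⟨x, hx⟩
    rw [← show c • e α = x from congrArg Subtype.val hc]
    exact N.smul_mem c (e_mem α)
  have coroot_mem (α : Weight K H g) (hα : α.IsNonZero) : (coroot α : g) ∈ N := by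
    obtain ⟨x, e', f, ht, he', hf⟩ := exists_isSl2Triple_of_weight_isNonZero hα
    rw [← ht.h_eq_coroot hα he' hf, ← ht.lie_e_f]
    exact N.lie_mem (rootSpace_le α hα he') (rootSpace_le (-α) (by simpa using hα) hf)
  have cartan_le (x : H) : (x : g) ∈ N := by
    have hx : x ∈ Submodule.span K (Set.range (rootSystem H).coroot) := by simp
    induction hx using Submodule.span_induction with
    | mem x hx =>
      obtain ⟨α, rfl⟩ := hx
      exact coroot_mem α (LieSubalgebra.isNonZero_coe_root α)
    | zero => exact N.zero_mem
    | add x y _ _ hx hy => exact N.add_mem hx hy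
    | smul r x _ hx => exact N.smul_mem r hx
  have top_le : (⊤ : Submodule K g) ≤ N.toSubmodule := by
    have := congrArg LieSubmodule.toSubmodule (cartan_sup_iSup_rootSpace_eq_top (H := H) (K := K))
    simp only [LieSubmodule.sup_toSubmodule, LieSubmodule.iSup_toSubmodule,
      LieSubmodule.top_toSubmodule] at this
    rw [← this]
    refine sup_le (fun x hx ↦ cartan_le ⟨x, hx⟩) (iSup₂_le fun α hα x hx ↦ rootSpace_le α hα hx)
  exact eq_top_iff.mpr fun x _ ↦ top_le (Submodule.mem_top (x := x))

end

/-! ### Descent of generating pairs along field extensions -/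

section

open LieAlgebra LieModule Module
open scoped TensorProduct

theorem LieAlgebra.IsKilling.baseChange (K E g : Type*) [Field K] [Field E] [Algebra K E]
    [LieRing g] [LieAlgebra K g] [FiniteDimensional K g] [IsKilling K g] :
    IsKilling E (E ⊗[K] g) where
  killingCompl_top_eq_bot := by
    let B := finBasis K g
    have hdet := (LinearMap.BilinForm.nondegenerate_iff_det_ne_zero (B := killingForm K g) B).mp
      (IsKilling.killingForm_nondegenerate K g)
    have hmat : LinearMap.BilinForm.toMatrix (Algebra.TensorProduct.basis E B)
        (killingForm E (E ⊗[K] g)) =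
          (LinearMap.BilinForm.toMatrix B (killingForm K g)).map (algebraMap K E) := by
      ext i j
      rw [killingForm, traceForm_baseChange]
      simp [LinearMap.BilinForm.toMatrix_apply, Algebra.algebraMap_eq_smul_one]
    have hE : (killingForm E (E ⊗[K] g)).Nondegenerate := by
      rw [LinearMap.BilinForm.nondegenerate_iff_det_ne_zero (Algebra.TensorProduct.basis E B), hmat,
        ← RingHom.mapMatrix_apply, ← RingHom.map_det]
      simpa using hdet
    refine (LieSubmodule.eq_bot_iff _).mpr fun x hx ↦ hE.2 x fun y ↦ ?_
    exact (LieIdeal.mem_killingCompl E (E ⊗[K] g) ⊤).mp hx y (LieSubmodule.mem_top y)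

/-- A homomorphism of scalars acts on `S ⊗ g` coordinatewise. -/
theorem LieAlgebra.ExtendScalars.basis_repr_map {K S T g ι : Type*} [CommRing K] [CommRing S]
    [CommRing T] [Algebra K S] [Algebra K T] [LieRing g] [LieAlgebra K g]
    (B : Module.Basis ι K g) (φ : S →ₐ[K] T) (z : S ⊗[K] g) (i : ι) :
    (Algebra.TensorProduct.basis T B).repr (ExtendScalars.map φ (LieHom.id : g →ₗ⁅K⁆ g) z) i =
      φ ((Algebra.TensorProduct.basis S B).repr z i) := by
  induction z with
  | zero => simp
  | tmul s x => simp
  | add x y hx hy => simp [hx, hy]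

theorem LieAlgebra.ExtendScalars.basis_det_map {K S T g ι : Type*} [CommRing K] [CommRing S]
    [CommRing T] [Algebra K S] [Algebra K T] [LieRing g] [LieAlgebra K g] [Fintype ι]
    [DecidableEq ι] (B : Module.Basis ι K g) (φ : S →ₐ[K] T) (z : ι → S ⊗[K] g) :
    (Algebra.TensorProduct.basis T B).det
        (fun j ↦ ExtendScalars.map φ (LieHom.id : g →ₗ⁅K⁆ g) (z j)) =
      φ ((Algebra.TensorProduct.basis S B).det z) := by
  rw [Module.Basis.det_apply, Module.Basis.det_apply, AlgHom.map_det]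
  congr 1
  ext i j
  simp [Module.Basis.toMatrix_apply, basis_repr_map]

/-- The `E`-span of the image of a Lie algebra over `K` is closed under the bracket, so it contains
the Lie algebra over `E` generated by any subset of that image. -/
theorem LieSubalgebra.lieSpan_le_span_image {K E g g' : Type*} [CommRing K] [CommRing E]
    [LieRing g] [LieAlgebra K g] [LieRing g'] [LieAlgebra K g'] [LieAlgebra E g']
    (f : g →ₗ⁅K⁆ g') (N : LieSubalgebra K g) {s : Set g'} (hs : s ⊆ f '' N) :
    (lieSpan E g' s).toSubmodule ≤ Submodule.span E (f '' N) := by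
  intro x hx
  change x ∈ lieSpan E g' s at hx
  induction hx using lieSpan_induction with
  | mem x hx => exact Submodule.subset_span (hs hx)
  | zero => exact zero_mem _
  | add x y _ _ hx hy => exact add_mem hx hy
  | smul r x _ hx => exact Submodule.smul_mem _ r hx
  | lie x y _ _ hx hy =>
    clear * - hx hy
    induction hx, hy using Submodule.span_induction₂ with
    | mem_mem x y hx hy =>
      obtain ⟨x, hx, rfl⟩ := hx
      obtain ⟨y, hy, rfl⟩ := hy
      exact Submodule.subset_span ⟨⁅x, y⁆, N.lie_mem hx hy, LieHom.map_lie f x y⟩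
    | zero_left => simp
    | zero_right => simp
    | add_left x y z _ _ _ hx hy => rw [add_lie]; exact add_mem hx hy
    | add_right x y z _ _ _ hx hy => rw [lie_add]; exact add_mem hx hy
    | smul_left r x y _ _ h => rw [smul_lie]; exact Submodule.smul_mem _ r h
    | smul_right r x y _ _ h => rw [lie_smul]; exact Submodule.smul_mem _ r h

/-- A Lie algebra `g` over an infinite field is generated by two elements as soon as some extension
of scalars `E ⊗ g` is. The brackets of a generic pair, with independent polynomial coordinates, have
a coordinate determinant which does not vanish at the given pair over `E`; it is therefore a
nonzero polynomial, and does not vanish at a suitable pair over `K` either. -/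
theorem LieSubalgebra.exists_lieSpan_pair_eq_top_of_baseChange {K E g : Type*} [Field K]
    [Infinite K] [Field E] [Algebra K E] [LieRing g] [LieAlgebra K g] [FiniteDimensional K g]
    {a b : E ⊗[K] g} (h : lieSpan E (E ⊗[K] g) {a, b} = ⊤) :
    ∃ a₀ b₀ : g, lieSpan K g {a₀, b₀} = ⊤ := by
  classical
  let B := finBasis K g
  set ι := Fin (finrank K g)
  let A₁ : MvPolynomial (ι ⊕ ι) K ⊗[K] g := ∑ i, MvPolynomial.X (Sum.inl i) ⊗ₜ B i
  let A₂ : MvPolynomial (ι ⊕ ι) K ⊗[K] g := ∑ i, MvPolynomial.X (Sum.inr i) ⊗ₜ B i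
  set N := lieSpan K (MvPolynomial (ι ⊕ ι) K ⊗[K] g) {A₁, A₂}
  -- The specialisation of the generic pair to `(a, b)`.
  let BE := Algebra.TensorProduct.basis E B
  let φ : MvPolynomial (ι ⊕ ι) K →ₐ[K] E := MvPolynomial.aeval (Sum.elim (BE.repr a) (BE.repr b))
  let ev := ExtendScalars.map φ (LieHom.id : g →ₗ⁅K⁆ g)
  have ev_A₁ : ev A₁ = a := by
    rw [← BE.sum_repr a]
    simp [ev, A₁, φ, BE, Algebra.TensorProduct.basis_apply, TensorProduct.smul_tmul']
  have ev_A₂ : ev A₂ = b := by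
    rw [← BE.sum_repr b]
    simp [ev, A₂, φ, BE, Algebra.TensorProduct.basis_apply, TensorProduct.smul_tmul']
  have span_eq : Submodule.span E (ev '' N) = ⊤ := by
    have := lieSpan_le_span_image (E := E) ev N (s := {a, b}) (by
      rintro x (rfl | rfl)
      · exact ⟨A₁, subset_lieSpan (by simp), ev_A₁⟩
      · exact ⟨A₂, subset_lieSpan (by simp), ev_A₂⟩)
    rwa [h, top_toSubmodule, top_le_iff] at this
  obtain ⟨v, hv⟩ : ∃ v : Basis ι E (E ⊗[K] g), ∀ i, v i ∈ ev '' N := by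
    let v₀ := Basis.ofSpan span_eq.ge
    refine ⟨v₀.reindex (v₀.indexEquiv BE), fun i ↦ Basis.ofSpan_subset span_eq.ge ?_⟩
    rw [Basis.reindex_apply]
    exact Set.mem_range_self _
  choose z hz hzv using hv
  -- The coordinate determinant of `z` is a nonzero polynomial, so it is nonzero at some point of
  -- the infinite field `K`.
  have hM : (Algebra.TensorProduct.basis (MvPolynomial (ι ⊕ ι) K) B).det z ≠ 0 := by
    intro h0
    have h1 := ExtendScalars.basis_det_map B φ z
    rw [h0, map_zero, show (fun j ↦ ExtendScalars.map φ (LieHom.id : g →ₗ⁅K⁆ g) (z j)) = v from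
      funext hzv] at h1
    exact (BE.isUnit_det v).ne_zero h1
  obtain ⟨c, hc⟩ : ∃ c : ι ⊕ ι → K, MvPolynomial.aeval c
      ((Algebra.TensorProduct.basis (MvPolynomial (ι ⊕ ι) K) B).det z) ≠ 0 := by
    by_contra! hc
    exact hM (MvPolynomial.funext fun c ↦ by simpa [MvPolynomial.aeval_eq_eval] using hc c)
  let ev₀ := ExtendScalars.map (MvPolynomial.aeval c) (LieHom.id : g →ₗ⁅K⁆ g)
  refine ⟨∑ i, c (Sum.inl i) • B i, ∑ i, c (Sum.inr i) • B i, ?_⟩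
  set N₀ := lieSpan K g {∑ i, c (Sum.inl i) • B i, ∑ i, c (Sum.inr i) • B i}
  have map_mem (y : MvPolynomial (ι ⊕ ι) K ⊗[K] g) (hy : y ∈ N) : ∃ x ∈ N₀, ev₀ y = 1 ⊗ₜ x := by
    induction hy using lieSpan_induction with
    | mem y hy =>
      rcases hy with rfl | rfl
      · refine ⟨∑ i, c (Sum.inl i) • B i, subset_lieSpan (by simp), ?_⟩
        simp [ev₀, A₁, TensorProduct.tmul_sum, TensorProduct.smul_tmul']
      · refine ⟨∑ i, c (Sum.inr i) • B i, subset_lieSpan (by simp), ?_⟩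
        simp [ev₀, A₂, TensorProduct.tmul_sum, TensorProduct.smul_tmul']
    | zero => exact ⟨0, zero_mem _, by simp⟩
    | add x y _ _ hx hy =>
      obtain ⟨x', hx', hx⟩ := hx
      obtain ⟨y', hy', hy⟩ := hy
      exact ⟨x' + y', add_mem hx' hy', by rw [map_add, hx, hy, TensorProduct.tmul_add]⟩
    | smul r x _ hx =>
      obtain ⟨x', hx', hx⟩ := hx
      exact ⟨r • x', N₀.smul_mem r hx', by rw [map_smul, hx, TensorProduct.tmul_smul]⟩
    | lie x y _ _ hx hy =>
      obtain ⟨x', hx', hx⟩ := hx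
      obtain ⟨y', hy', hy⟩ := hy
      exact ⟨⁅x', y'⁆, N₀.lie_mem hx' hy', by
        rw [LieHom.map_lie, hx, hy, ExtendScalars.bracket_tmul, one_mul]⟩
  have span_ev₀ : Submodule.span K (Set.range fun j ↦ ev₀ (z j)) = ⊤ :=
    ((Algebra.TensorProduct.basis K B).is_basis_iff_det.mpr (by
      rw [ExtendScalars.basis_det_map]
      exact hc.isUnit)).2
  have le_N₀ : (⊤ : Submodule K (K ⊗[K] g)) ≤
      N₀.toSubmodule.comap (TensorProduct.lid K g).toLinearMap := by
    rw [← span_ev₀, Submodule.span_le]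
    rintro _ ⟨j, rfl⟩
    obtain ⟨x, hx, hx'⟩ := map_mem (z j) (hz j)
    simpa [hx'] using hx
  refine eq_top_iff.mpr fun x _ ↦ ?_
  simpa using le_N₀ (Submodule.mem_top (x := (1 : K) ⊗ₜ[K] x))

/-- A finite-dimensional Lie algebra with nondegenerate Killing form over a field of characteristic
zero is generated by two elements. -/
theorem LieAlgebra.IsKilling.exists_lieSpan_pair_eq_top (K g : Type*) [Field K] [CharZero K]
    [LieRing g] [LieAlgebra K g] [FiniteDimensional K g] [IsKilling K g] :
    ∃ a b : g, LieSubalgebra.lieSpan K g {a, b} = ⊤ := by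
  have := IsKilling.baseChange K (AlgebraicClosure K) g
  obtain ⟨a, b, h⟩ := exists_lieSpan_pair_eq_top_of_isAlgClosed (AlgebraicClosure K)
    (AlgebraicClosure K ⊗[K] g)
  exact LieSubalgebra.exists_lieSpan_pair_eq_top_of_baseChange h

end

/-! ### Two generators modulo the identity -/

namespace LieJordanAlgebra

variable {L : Type*} [LieRing L] [LieAlgebra ℝ L] [LieJordanAlgebra L]

/-- Generators of the Lie algebra `L ⧸ ℝ1` lift to generators of `L`, in the sense in which the
identity is available for free. -/
theorem lieGenerates_of_lieSpan_quotient_eq_top {a b : L}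
    (h : LieSubalgebra.lieSpan ℝ (L ⧸ identityIdeal L)
      {LieSubmodule.Quotient.mk' (identityIdeal L) a,
        LieSubmodule.Quotient.mk' (identityIdeal L) b} = ⊤) :
    LieGenerates ({a, b} : Set L) := by
  refine eq_top_iff.mpr fun x _ ↦ ?_
  set N := LieSubalgebra.lieSpan ℝ L (identities L ∪ {a, b})
  have le_N : ∀ z ∈ identityIdeal L, z ∈ N := by
    intro z hz
    have : Submodule.span ℝ (identities L) ≤ N.toSubmodule :=
      Submodule.span_le.mpr (Set.subset_union_left.trans LieSubalgebra.subset_lieSpan)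
    exact this hz
  have key : ∀ q : L ⧸ identityIdeal L, ∃ y ∈ N,
      LieSubmodule.Quotient.mk' (identityIdeal L) y = q := by
    intro q
    have hq : q ∈ LieSubalgebra.lieSpan ℝ (L ⧸ identityIdeal L)
      {LieSubmodule.Quotient.mk' (identityIdeal L) a,
        LieSubmodule.Quotient.mk' (identityIdeal L) b} := by rw [h]; trivial
    induction hq using LieSubalgebra.lieSpan_induction with
    | mem q hq =>
      rcases hq with rfl | rfl
      · exact ⟨a, LieSubalgebra.subset_lieSpan (by simp), rfl⟩
      · exact ⟨b, LieSubalgebra.subset_lieSpan (by simp), rfl⟩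
    | zero => exact ⟨0, zero_mem _, by simp⟩
    | add x y _ _ hx hy =>
      obtain ⟨x', hx', rfl⟩ := hx
      obtain ⟨y', hy', rfl⟩ := hy
      exact ⟨x' + y', add_mem hx' hy', by simp⟩
    | smul r x _ hx =>
      obtain ⟨x', hx', rfl⟩ := hx
      exact ⟨r • x', N.smul_mem r hx', by simp⟩
    | lie x y _ _ hx hy =>
      obtain ⟨x', hx', rfl⟩ := hx
      obtain ⟨y', hy', rfl⟩ := hy
      exact ⟨⁅x', y'⁆, N.lie_mem hx' hy', rfl⟩
  obtain ⟨y, hy, hxy⟩ := key (LieSubmodule.Quotient.mk' (identityIdeal L) x)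
  have : x - y ∈ identityIdeal L := by
    rw [← LieSubmodule.Quotient.mk_eq_zero, map_sub, hxy, sub_self]
  simpa using add_mem (le_N _ this) hy

theorem IsSemisimple.exists_lieGenerates [FiniteDimensional ℝ L] (hL : IsSemisimple L) :
    ∃ a b : L, LieGenerates ({a, b} : Set L) := by
  have : LieAlgebra.IsSemisimple ℝ (L ⧸ identityIdeal L) := hL
  have : FiniteDimensional ℝ (L ⧸ identityIdeal L) :=
    Module.Finite.quotient ℝ (identityIdeal L).toSubmodule
  obtain ⟨a, b, h⟩ := LieAlgebra.IsKilling.exists_lieSpan_pair_eq_top ℝ (L ⧸ identityIdeal L)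
  obtain ⟨a, rfl⟩ := LieSubmodule.Quotient.surjective_mk' _ a
  obtain ⟨b, rfl⟩ := LieSubmodule.Quotient.surjective_mk' _ b
  exact ⟨a, b, lieGenerates_of_lieSpan_quotient_eq_top h⟩

end LieJordanAlgebra

theorem theorem5 (L : Type*) [LieRing L] [LieAlgebra ℝ L] [LieJordanAlgebra L]
    [FiniteDimensional ℝ L] (hL : LieJordanAlgebra.IsSemisimple L) :
    (∃ x y z : L, LieJordanAlgebra.JordanGenerates ({x, y, z} : Set L)) ∧
    (∃ a b : L, LieJordanAlgebra.LieGenerates ({a, b} : Set L)) ∧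
    (∀ a b : L, LieJordanAlgebra.LieGenerates ({a, b} : Set L) →
      LieJordanAlgebra.JordanGenerates ({a, b, ⁅a, b⁆} : Set L)) := by
  obtain ⟨a, b, h⟩ := hL.exists_lieGenerates
  exact ⟨⟨a, b, ⁅a, b⁆, h.jordanGenerates⟩, ⟨a, b, h⟩, fun _ _ h ↦ h.jordanGenerates⟩
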